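/- Let $W_0$ be a finite group and let $L$ be a $\mathbb{Z}[W_0]$-lattice, i.e. a $\mathbb{Z}[W_0]$-module whose underlying abelian group is free of finite rank. Call a module irreducible if its only submodules are $0$ and the whole module, and suppose that $L$ is absolutely irreducible, i.e. that for every field extension $K$ of $\mathbb{Q}$ the $K[W_0]$-module $K\otimes_{\mathbb{Q}}(\mathbb{Q}\otimes_{\mathbb{Z}}L)$ is irreducible. A centering of $L$ is a $\mathbb{Z}[W_0]$-submodule of finite index in $L$, and the centerings are partially ordered by $C\prec C'$ if and only if $C=\lambda C'$ for some $\lambda\in\mathbb{Z}$. Then $L$ has only finitely many $\prec$-maximal centerings. -/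

import Mathlib

open scoped MonoidAlgebra TensorProduct Pointwise

universe w u v

/-- Extension of scalars of a `k[G]`-module, in the form of a representation: `G` acts on
`K ⊗[k] V` by `g (a ⊗ x) = a ⊗ g x`, so `∑ aᵢ gᵢ` in `K[G]` acts on its module
`(extendScalars K ρ).asModule` by `(∑ aᵢ gᵢ) (b ⊗ x) = ∑ aᵢ b ⊗ gᵢ x`. -/
noncomputable def extendScalars {k : Type*} [CommRing k] (K : Type*) [CommRing K] [Algebra k K]
    {G : Type*} [Group G] {V : Type*} [AddCommGroup V] [Module k V] (ρ : Representation k G V) :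
    Representation K G (K ⊗[k] V) :=
  (Module.End.baseChangeHom k K V : Module.End k V →* Module.End K (K ⊗[k] V)).comp ρ

/-- A module is irreducible if its only submodules are `0` and the whole module
(the zero module is allowed). -/
def IsIrreducibleModule (R M : Type*) [Ring R] [AddCommGroup M] [Module R M] : Prop :=
  ∀ N : Submodule R M, N = ⊥ ∨ N = ⊤

/-- A `ℚ[G]`-module `V` (given as a representation over `ℚ`) is absolutely irreducible if
the `K[G]`-module `K ⊗[ℚ] V` is irreducible for every field extension `K` of `ℚ`. -/
def IsAbsolutelyIrreducible {G : Type u} [Group G] {V : Type v} [AddCommGroup V]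
    [Module ℚ V] (ρ : Representation ℚ G V) : Prop :=
  ∀ (K : Type w) [Field K] [Algebra ℚ K],
    IsIrreducibleModule K[G] (extendScalars K ρ).asModule

/-- `L` is a `ℤ[G]`-lattice: a `ℤ[G]`-module whose additive group is free of finite rank. -/
structure IsGroupRingLattice (G L : Type*) [Group G] [AddCommGroup L] [Module ℤ[G] L] :
    Prop where
  free : Module.Free ℤ L
  finite : Module.Finite ℤ L

/-- The `ℚ[G]`-module `ℚ ⊗[ℤ] L` attached to a `ℤ[G]`-module `L`, as a representation. -/
noncomputable def rationalExtension (G L : Type*) [Group G] [AddCommGroup L] [Module ℤ[G] L] :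
    Representation ℚ G (ℚ ⊗[ℤ] L) :=
  extendScalars ℚ (Representation.ofModule' (k := ℤ) (G := G) L)

/-- A `ℤ[G]`-lattice `L` is absolutely irreducible if `ℚ ⊗[ℤ] L` is. -/
def IsAbsolutelyIrreducibleLattice (G : Type u) (L : Type v) [Group G] [AddCommGroup L]
    [Module ℤ[G] L] : Prop :=
  IsAbsolutelyIrreducible.{w} (rationalExtension G L)

/-- A centering of `L`: a `ℤ[G]`-submodule of finite index. -/
@[ext]
structure Centering (G L : Type*) [Group G] [AddCommGroup L] [Module ℤ[G] L] where
  toSubmodule : Submodule ℤ[G] L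
  finiteIndex : toSubmodule.toAddSubgroup.FiniteIndex

/-- The order `≺` on centerings: `C ≤ C'` means that `C = n C' = {n x | x ∈ C'}` for some
integer `n`. (This is not the inclusion order.) -/
instance Centering.instPartialOrder (G L : Type*) [Group G] [AddCommGroup L] [Module ℤ[G] L] :
    PartialOrder (Centering G L) where
  le C C' := ∃ n : ℤ, C.toSubmodule = n • C'.toSubmodule
  le_refl C := ⟨1, (one_smul ℤ C.toSubmodule).symm⟩
  le_trans := by
    rintro A B C ⟨m, hm⟩ ⟨n, hn⟩
    exact ⟨m * n, by rw [hm, hn, mul_smul]⟩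
  le_antisymm := by
    have key : ∀ (n : ℤ) (N : Submodule ℤ[G] L), n • N ≤ N := by
      intro n N x hx
      obtain ⟨y, hy, rfl⟩ := Submodule.mem_smul_pointwise_iff_exists _ _ _ |>.1 hx
      exact zsmul_mem hy n
    rintro A B ⟨m, hm⟩ ⟨n, hn⟩
    exact Centering.ext (le_antisymm (hm.trans_le (key m _)) (hn.trans_le (key n _)))

/-! Absolute irreducibility and Burnside's theorem, descended from an algebraically closed field,
make `ℚ[G]` surject onto the endomorphisms of `ℚ ⊗ L`. Clearing denominators gives one `M ≠ 0` such
that `M` times every matrix unit of `L` comes from `ℤ[G]` (`exists_smul_eq_smul_coord_smul`).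
Applied to a centering `C`, these elements put `M c b j` in `C` for every coordinate `c` of an
element of `C`. If `C` is maximal, its coordinates have no common non-unit divisor
(`Centering.isUnit_of_isMax`), so `M L ⊆ C ⊆ L`, and `L / M L` is finite. -/

section Burnside

variable {G : Type*} [Group G]

/-- **Burnside's theorem**: over an algebraically closed field, the group algebra surjects onto the
endomorphisms of a finite-dimensional irreducible representation. -/
theorem asAlgebraHom_surjective_of_isIrreducibleModule {K : Type*} [Field K] [IsAlgClosed K]
    {V : Type*} [AddCommGroup V] [Module K V] [FiniteDimensional K V] (ρ : Representation K G V)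
    (h : IsIrreducibleModule K[G] ρ.asModule) : Function.Surjective ρ.asAlgebraHom := by
  intro f
  rcases subsingleton_or_nontrivial V with hV | hV
  · exact ⟨0, LinearMap.ext fun x => Subsingleton.elim _ _⟩
  have : Nontrivial ρ.asModule := hV
  have : IsSimpleModule K[G] ρ.asModule :=
    { toIsSimpleOrder := { eq_bot_or_eq_top := h } }
  have hschur := (IsSimpleModule.algebraMap_end_bijective_of_isAlgClosed (A := K[G])
    (V := ρ.asModule) K).2
  -- By Schur the commutant consists of scalars, so any `K`-linear `f` commutes with it and the
  -- density theorem applies.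
  let F : Module.End (Module.End K[G] ρ.asModule) ρ.asModule :=
    { toFun := fun x => ρ.asModuleEquiv.symm (f (ρ.asModuleEquiv x))
      map_add' := by simp
      map_smul' := by
        intro e x
        obtain ⟨c, rfl⟩ := hschur e
        change ρ.asModuleEquiv.symm (f (ρ.asModuleEquiv (c • x))) =
          c • ρ.asModuleEquiv.symm (f (ρ.asModuleEquiv x))
        simp only [map_smul] }
  obtain ⟨s, hs⟩ := (Module.Finite.fg_top : (⊤ : Submodule K V).FG)
  classical
  obtain ⟨r, hr⟩ := jacobson_density F (s.image ρ.asModuleEquiv.symm)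
  refine ⟨r, LinearMap.ext_on hs fun x hx => ?_⟩
  have := congrArg ρ.asModuleEquiv (hr _ (Finset.mem_image_of_mem _ hx))
  rw [Representation.asModuleEquiv_map_smul] at this
  simpa [F] using this.symm

/-- A functional killing the image of `k[G]` extends, in coordinates, to one over `K` killing the
image of `K[G]`, hence vanishes. -/
theorem asAlgebraHom_surjective_of_extendScalars {k : Type*} [Field k] {K : Type*} [Field K]
    [Algebra k K] {V : Type*} [AddCommGroup V] [Module k V] [FiniteDimensional k V]
    (ρ : Representation k G V) (h : Function.Surjective (extendScalars K ρ).asAlgebraHom) :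
    Function.Surjective ρ.asAlgebraHom := by
  classical
  change Function.Surjective ρ.asAlgebraHom.toLinearMap
  rw [← LinearMap.range_eq_top]
  by_contra hne
  obtain ⟨φ, hφ, hle⟩ := Submodule.exists_le_ker_of_lt_top _ (lt_top_iff_ne_top.2 hne)
  have hvanish : ∀ g, φ (ρ g) = 0 := fun g =>
    hle ⟨MonoidAlgebra.of k G g, by simp⟩
  let b := Module.finBasis k V
  let bK := b.baseChange K
  let E := fun i j => Matrix.toLin b b (Matrix.single i j (1 : k))
  have hφE : ∀ f, φ f = ∑ i, ∑ j, LinearMap.toMatrix b b f i j * φ (E i j) := by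
    intro f
    conv_lhs => rw [← Matrix.toLin_toMatrix b b f,
      Matrix.matrix_eq_sum_single (LinearMap.toMatrix b b f)]
    simp only [map_sum]
    refine Finset.sum_congr rfl fun i _ => Finset.sum_congr rfl fun j _ => ?_
    rw [← mul_one (LinearMap.toMatrix b b f i j), ← smul_eq_mul, ← Matrix.smul_single, map_smul,
      map_smul]
    simp [E]
  let φK : Module.End K (K ⊗[k] V) →ₗ[K] K :=
    { toFun := fun F => ∑ i, ∑ j, LinearMap.toMatrix bK bK F i j * algebraMap k K (φ (E i j))
      map_add' := by intro x y; simp [add_mul, Finset.sum_add_distrib]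
      map_smul' := by intro c x; simp [mul_assoc, Finset.mul_sum] }
  have hφK : ∀ f : Module.End k V, φK (f.baseChange K) = algebraMap k K (φ f) := by
    intro f
    rw [hφE f]
    simp [φK, bK, LinearMap.toMatrix_apply, Module.Basis.baseChange_repr_tmul,
      Algebra.algebraMap_eq_smul_one, smul_smul, mul_comm]
  have hzero : ∀ r, φK ((extendScalars K ρ).asAlgebraHom r) = 0 := by
    intro r
    induction r using MonoidAlgebra.induction_linear with
    | zero => simp
    | add x y hx hy => simp [hx, hy]
    | single g c =>
      have : extendScalars K ρ g = (ρ g).baseChange K := rfl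
      rw [Representation.asAlgebraHom_single, map_smul, this, hφK, hvanish]
      simp
  refine hφ (LinearMap.ext fun f => ?_)
  obtain ⟨r, hr⟩ := h (f.baseChange K)
  have := hzero r
  rw [hr, hφK] at this
  simpa using this

end Burnside

section Lattice

variable {G : Type u} [Group G] {L : Type v} [AddCommGroup L] [Module ℤ[G] L]

theorem asAlgebraHom_rationalExtension_surjective (hL : IsGroupRingLattice G L)
    (hirr : IsAbsolutelyIrreducibleLattice.{w} G L) :
    Function.Surjective (rationalExtension G L).asAlgebraHom := by
  have := hL.finite
  -- `ULift` puts the field in the universe over which `hirr` quantifies.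
  exact asAlgebraHom_surjective_of_extendScalars (K := AlgebraicClosure (ULift.{w} ℚ)) _
    (asAlgebraHom_surjective_of_isIrreducibleModule _ (hirr _))

theorem rationalExtension_apply_tmul (g : G) (q : ℚ) (x : L) :
    rationalExtension G L g (q ⊗ₜ x) = q ⊗ₜ[ℤ] (MonoidAlgebra.of ℤ G g • x) := rfl

/-- Every element of `ℚ[G]` acts on `L` as an element of `ℤ[G]`, up to a denominator. -/
theorem exists_smul_asAlgebraHom_rationalExtension (r : ℚ[G]) :
    ∃ N : ℤ, N ≠ 0 ∧ ∃ a : ℤ[G], ∀ x : L,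
      N • (rationalExtension G L).asAlgebraHom r (1 ⊗ₜ x) = 1 ⊗ₜ[ℤ] (a • x) := by
  induction r using MonoidAlgebra.induction_linear with
  | zero => exact ⟨1, one_ne_zero, 0, by simp⟩
  | add r s hr hs =>
    obtain ⟨M, hM, a, ha⟩ := hr
    obtain ⟨N, hN, b, hb⟩ := hs
    refine ⟨M * N, mul_ne_zero hM hN, N • a + M • b, fun x => ?_⟩
    rw [map_add, LinearMap.add_apply, smul_add, mul_comm M N, mul_smul, ha, mul_comm N M, mul_smul,
      hb, add_smul, smul_assoc, smul_assoc, TensorProduct.tmul_add,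
      TensorProduct.tmul_smul N, TensorProduct.tmul_smul M]
  | single g q =>
    refine ⟨q.den, by simp, MonoidAlgebra.single g q.num, fun x => ?_⟩
    rw [Representation.asAlgebraHom_single, LinearMap.smul_apply, rationalExtension_apply_tmul,
      ← mul_one q.num, ← smul_eq_mul, ← MonoidAlgebra.smul_single, smul_assoc,
      TensorProduct.tmul_smul q.num, MonoidAlgebra.of_apply]
    simp only [TensorProduct.smul_tmul']
    congr 1
    simp [Rat.den_mul_eq_num]

/-- A nonzero multiple of any additive endomorphism of `L` is given by an element of `ℤ[G]`. -/
theorem exists_smul_eq_zsmul_apply (hL : IsGroupRingLattice G L)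
    (hirr : IsAbsolutelyIrreducibleLattice.{w} G L) (e : L →ₗ[ℤ] L) :
    ∃ N : ℤ, N ≠ 0 ∧ ∃ a : ℤ[G], ∀ x : L, a • x = N • e x := by
  have := hL.free
  obtain ⟨r, hr⟩ := asAlgebraHom_rationalExtension_surjective.{w} hL hirr (e.baseChange ℚ)
  obtain ⟨N, hN, a, ha⟩ := exists_smul_asAlgebraHom_rationalExtension (L := L) r
  refine ⟨N, hN, a, fun x => ?_⟩
  have hinj : Function.Injective fun y : L => (1 : ℚ) ⊗ₜ[ℤ] y := by
    have := Module.Flat.rTensor_preserves_injective_linearMap (M := L) (Algebra.linearMap ℤ ℚ)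
      Int.cast_injective
    intro y z hyz
    apply (TensorProduct.lid ℤ L).symm.injective
    apply this
    simpa using hyz
  apply hinj
  have := ha x
  rw [hr, LinearMap.baseChange_tmul, ← TensorProduct.tmul_smul] at this
  exact this.symm

/-- The matrix units of `L` become elements of `ℤ[G]` after scaling by a common nonzero integer. -/
theorem exists_smul_eq_smul_coord_smul {ι : Type*} [Finite ι] (b : Module.Basis ι ℤ L)
    (hL : IsGroupRingLattice G L) (hirr : IsAbsolutelyIrreducibleLattice.{w} G L) :
    ∃ M : ℕ, M ≠ 0 ∧ ∀ i j, ∃ a : ℤ[G], ∀ x : L, a • x = (M * b.coord i x) • b j := by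
  have := Fintype.ofFinite ι
  choose N hN a ha using fun p : ι × ι =>
    exists_smul_eq_zsmul_apply.{w} hL hirr ((b.coord p.1).smulRight (b p.2))
  refine ⟨(∏ p, N p).natAbs, by simp [Finset.prod_eq_zero_iff, hN], fun i j => ?_⟩
  obtain ⟨c, hc⟩ : N (i, j) ∣ ((∏ p, N p).natAbs : ℤ) :=
    Int.dvd_natAbs.2 (Finset.dvd_prod_of_mem N (Finset.mem_univ _))
  refine ⟨c • a (i, j), fun x => ?_⟩
  rw [smul_assoc, ha, hc, LinearMap.smulRight_apply, smul_smul, smul_smul]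
  congr 1
  ring

theorem Centering.exists_zsmul_mem (C : Centering G L) :
    ∃ n : ℤ, n ≠ 0 ∧ ∀ x, n • x ∈ C.toSubmodule := by
  have := C.finiteIndex
  refine ⟨C.toSubmodule.toAddSubgroup.index, by exact_mod_cast this.index_ne_zero, fun x => ?_⟩
  rw [natCast_zsmul]
  exact C.toSubmodule.toAddSubgroup.nsmul_index_mem x

/-- The centering `{x | d x ∈ C}`. -/
def Centering.colon (C : Centering G L) (d : ℤ) : Centering G L where
  toSubmodule :=
    { carrier := {x | d • x ∈ C.toSubmodule}
      add_mem' := fun {x y} hx hy => by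
        simpa only [Set.mem_ofPred_eq, smul_add] using add_mem hx hy
      zero_mem' := by simp
      smul_mem' := fun a x hx => by
        simpa only [Set.mem_ofPred_eq, smul_comm d a x] using C.toSubmodule.smul_mem a hx }
  finiteIndex := by
    have := C.finiteIndex
    refine AddSubgroup.finiteIndex_of_le (H := C.toSubmodule.toAddSubgroup) ?_
    intro x hx
    exact zsmul_mem (K := C.toSubmodule) hx d

theorem Centering.mem_colon {C : Centering G L} {d : ℤ} {x : L} :
    x ∈ (C.colon d).toSubmodule ↔ d • x ∈ C.toSubmodule := Iff.rfl

/-- A maximal centering of a nonzero lattice lies in `d L` only if `d` is a unit. -/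
theorem Centering.isUnit_of_isMax [Nontrivial L] (hL : IsGroupRingLattice G L)
    {C : Centering G L} (hC : IsMax C) {d : ℤ} (hd : ∀ x ∈ C.toSubmodule, ∃ y, x = d • y) :
    IsUnit d := by
  have := hL.free
  have := hL.finite
  have hCd : C.toSubmodule = d • (C.colon d).toSubmodule := by
    ext x
    rw [Submodule.mem_smul_pointwise_iff_exists]
    constructor
    · intro hx
      obtain ⟨y, rfl⟩ := hd x hx
      exact ⟨y, hx, rfl⟩
    · rintro ⟨y, hy, rfl⟩
      exact hy
  obtain ⟨m, hm⟩ := hC (show C ≤ C.colon d from ⟨d, hCd⟩)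
  rw [hCd, ← mul_smul] at hm
  let N : Submodule ℤ L := (C.colon d).toSubmodule.toAddSubgroup.toIntSubmodule
  have hN : N ≤ Ideal.span {m * d} • N := by
    intro x hx
    have hx' : x ∈ (C.colon d).toSubmodule := hx
    rw [hm, Submodule.mem_smul_pointwise_iff_exists] at hx'
    obtain ⟨y, hy, rfl⟩ := hx'
    exact Submodule.smul_mem_smul (Ideal.mem_span_singleton_self _) hy
  -- Nakayama: some `r ≡ 1` mod `m * d` kills `N`. As `N` is nonzero and torsion-free, `r = 0`, so
  -- `m * d ∣ 1`.
  obtain ⟨r, hr, hrN⟩ := Submodule.exists_sub_one_mem_and_smul_eq_zero_of_fg_of_le_smul _ N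
    (IsNoetherian.noetherian N) hN
  obtain ⟨n, hn, hnC⟩ := (C.colon d).exists_zsmul_mem
  obtain ⟨x, hx⟩ := exists_ne (0 : L)
  have hr0 : r = 0 := by
    simpa [hx, hn] using hrN _ (hnC x)
  rw [hr0, Ideal.mem_span_singleton, zero_sub, dvd_neg] at hr
  exact isUnit_of_dvd_one ((dvd_mul_left d m).trans hr)

end Lattice

theorem mainTheorem8 (W₀ : Type u) [Group W₀] [Finite W₀] (L : Type v) [AddCommGroup L]
    [Module ℤ[W₀] L] (hL : IsGroupRingLattice W₀ L)
    (hirr : IsAbsolutelyIrreducibleLattice.{w} W₀ L) :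
    {C : Centering W₀ L | IsMax C}.Finite := by
  have := hL.free
  have := hL.finite
  let b := Module.Free.chooseBasis ℤ L
  obtain ⟨M, hM, hMb⟩ := exists_smul_eq_smul_coord_smul.{w} b hL hirr
  have : NeZero M := ⟨hM⟩
  -- every maximal centering contains `M L`
  have key : ∀ C : Centering W₀ L, IsMax C → ∀ x, (M : ℤ) • x ∈ C.toSubmodule := by
    intro C hC
    rcases subsingleton_or_nontrivial L with hs | hs
    · intro x
      rw [Subsingleton.elim ((M : ℤ) • x) 0]
      exact zero_mem _
    -- `J` contains every coordinate of every element of `C`, so its generator `d` satisfies `C ⊆ d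
    -- L` and must be a unit.
    let J : Ideal ℤ :=
      { carrier := {m | ∀ j, ((M : ℤ) * m) • b j ∈ C.toSubmodule}
        add_mem' := fun {m n} hm hn j => by
          rw [mul_add, add_smul]
          exact add_mem (hm j) (hn j)
        zero_mem' := by simp
        smul_mem' := fun c m hm j => by
          rw [smul_eq_mul, mul_left_comm, mul_smul]
          exact zsmul_mem (hm j) c }
    obtain ⟨d, hd⟩ := (IsPrincipalIdealRing.principal J).principal
    have hdvd : ∀ x ∈ C.toSubmodule, ∃ y, x = d • y := by
      intro x hx
      have hcoord : ∀ i, d ∣ b.coord i x := by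
        intro i
        rw [← Ideal.mem_span_singleton, Ideal.span, ← hd]
        intro j
        obtain ⟨a, ha⟩ := hMb i j
        rw [← ha]
        exact C.toSubmodule.smul_mem a hx
      choose c hc using hcoord
      refine ⟨∑ i, c i • b i, ?_⟩
      conv_lhs => rw [← b.sum_repr x]
      rw [Finset.smul_sum]
      refine Finset.sum_congr rfl fun i _ => ?_
      rw [smul_smul, ← hc i, b.coord_apply]
    have h1 : (1 : ℤ) ∈ J := by
      rw [hd]
      exact Ideal.mem_span_singleton.2 (Centering.isUnit_of_isMax hL hC hdvd).dvd
    intro x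
    rw [← b.sum_repr x, Finset.smul_sum]
    refine sum_mem fun i _ => ?_
    rw [smul_comm, ← mul_one (M : ℤ)]
    exact zsmul_mem (h1 i) _
  -- Reduction mod `M`: a centering containing `M L` is recovered from its image in a finite set.
  let π : L → (Module.Free.ChooseBasisIndex ℤ L → ZMod M) := fun x i => (b.repr x i : ZMod M)
  have hπ : ∀ C : Centering W₀ L, IsMax C → ∀ x, π x ∈ π '' C.toSubmodule →
      x ∈ C.toSubmodule := by
    rintro C hC x ⟨y, hy, hyx⟩
    have hcoord : ∀ i, (M : ℤ) ∣ b.repr x i - b.repr y i := fun i =>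
      (ZMod.intCast_eq_intCast_iff_dvd_sub _ _ _).1 (congrFun hyx i)
    choose c hc using hcoord
    have hxy : x - y = (M : ℤ) • ∑ i, c i • b i := by
      rw [← b.sum_repr (x - y), Finset.smul_sum]
      refine Finset.sum_congr rfl fun i _ => ?_
      rw [smul_smul, ← hc i, map_sub, Finsupp.sub_apply]
    rw [← sub_add_cancel x y, hxy]
    exact add_mem (key C hC _) hy
  refine Set.Finite.of_injOn (f := fun C : Centering W₀ L => π '' C.toSubmodule)
    (Set.mapsTo_univ _ _) (fun C hC D hD hCD => ?_) Set.finite_univ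
  have hCD' : π '' (C.toSubmodule : Set L) = π '' (D.toSubmodule : Set L) := hCD
  refine Centering.ext (SetLike.ext fun x => ⟨fun hx => hπ D hD x ?_, fun hx => hπ C hC x ?_⟩)
  · exact hCD' ▸ Set.mem_image_of_mem π hx
  · exact hCD' ▸ Set.mem_image_of_mem π hx
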